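/- Let $K \subseteq \mathbb{R}^n$ be a convex body (a compact convex set with non-empty interior) that is smooth, i.e., at each $a \in \partial K$ there is a unique unit vector $v$ with $\langle v, x-a\rangle \ge 0$ for all $x \in K$. Assume that $K$ is ball-like: there exist $\epsilon_{insc}, \epsilon_{circ} > 0$ such that for every $x \in \partial K$ there are closed Euclidean balls $B_{insc}$ of radius $\epsilon_{insc}$ and $B_{circ}$ of radius $\epsilon_{circ}$ with $B_{insc} \subseteq K \subseteq B_{circ}$ and $x \in \partial B_{insc} \cap \partial B_{circ}$. For a polynomial $f \in \mathbb{R}[x_1,\dots,x_n]$ and $r \in \mathbb{N}$, write $f_{\min} = \min_{x \in K} f(x)$, and let $$f^{(r)} = \inf\Big\{ \int_K f(x) q(x)\,dx \;:\; q \in \Sigma_r,\ \int_K q(x)\,dx = 1 \Big\},$$ where $dx$ is the Lebesgue measure and $\Sigma_r$ is the set of sums of squares of real polynomials in $x_1,\dots,x_n$ that have degree at most $2r$. Let $E^{(r)}(f) = f^{(r)} - f_{\min}$, and let $\beta_{K,f} = \max_{x \in K} \|\nabla f(x)\|$ and $\gamma_{K,f} = \frac12 \max_{x\in K} \|\nabla^2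 f(x)\|$ (Euclidean norm and spectral norm, respectively). Then $E^{(r)}(f) = O(1/r^2)$. Precisely, there is a constant $c > 0$, depending only on $K$, $\beta_{K,f}$ and $\gamma_{K,f}$, such that $$E^{(r)}(f) \le \frac{c}{r^2} \qquad \text{for all integers } r \ge 1 .$$ -/

import Mathlib

open MeasureTheory

/-- The polynomial function on Euclidean space `ℝⁿ` defined by `f`. -/
noncomputable def polyFun {n : ℕ} (f : MvPolynomial (Fin n) ℝ) (x : EuclideanSpace ℝ (Fin n)) : ℝ :=
  MvPolynomial.eval (fun i => x i) f

/-- `f_min`, the minimum of `f` on `K`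
(attained, hence equal to the infimum, for `K` compact and nonempty). -/
noncomputable def polyMinOn {n : ℕ} (K : Set (EuclideanSpace ℝ (Fin n)))
    (f : MvPolynomial (Fin n) ℝ) : ℝ :=
  sInf (polyFun f '' K)

/-- `q` is a sum-of-squares density of degree at most `2r` on `K` with respect to `μ`:
`q ∈ Σ_r` and `∫_K q dμ = 1`. -/
def IsSosDensity {n : ℕ} (r : ℕ) (K : Set (EuclideanSpace ℝ (Fin n)))
    (μ : Measure (EuclideanSpace ℝ (Fin n))) (q : MvPolynomial (Fin n) ℝ) : Prop :=
  IsSumSq q ∧ q.totalDegree ≤ 2 * r ∧ ∫ x in K, polyFun q x ∂μ = 1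

/-- The Lasserre upper bound `f^{(r)}_{K,μ}`: the infimum of `∫_K f q dμ` over all
sum-of-squares densities `q` of degree at most `2r`. -/
noncomputable def lasserreBound {n : ℕ} (r : ℕ) (K : Set (EuclideanSpace ℝ (Fin n)))
    (μ : Measure (EuclideanSpace ℝ (Fin n))) (f : MvPolynomial (Fin n) ℝ) : ℝ :=
  sInf {v : ℝ | ∃ q : MvPolynomial (Fin n) ℝ, IsSosDensity r K μ q ∧
    v = ∫ x in K, polyFun f x * polyFun q x ∂μ}

/-- The error `E^{(r)}_{K,μ}(f) = f^{(r)}_{K,μ} - f_min`. -/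
noncomputable def lasserreError {n : ℕ} (r : ℕ) (K : Set (EuclideanSpace ℝ (Fin n)))
    (μ : Measure (EuclideanSpace ℝ (Fin n))) (f : MvPolynomial (Fin n) ℝ) : ℝ :=
  lasserreBound r K μ f - polyMinOn K f

/-- `β_{K,f} = max_{x ∈ K} ‖∇f(x)‖`. -/
noncomputable def gradBound {n : ℕ} (K : Set (EuclideanSpace ℝ (Fin n)))
    (f : MvPolynomial (Fin n) ℝ) : ℝ :=
  sSup ((fun x => ‖gradient (polyFun f) x‖) '' K)

/-- `γ_{K,f} = (1/2) max_{x ∈ K} ‖∇²f(x)‖`, where the Hessian `∇²f(x)` is the derivative at `x` of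
the gradient of `f`, measured in the operator (spectral) norm. -/
noncomputable def hessBound {n : ℕ} (K : Set (EuclideanSpace ℝ (Fin n)))
    (f : MvPolynomial (Fin n) ℝ) : ℝ :=
  (1 / 2 : ℝ) * sSup ((fun x => ‖fderiv ℝ (gradient (polyFun f)) x‖) '' K)

/-- The cone of inward normals of `K` at `a`. -/
def normalCone {n : ℕ} (K : Set (EuclideanSpace ℝ (Fin n))) (a : EuclideanSpace ℝ (Fin n)) :
    Set (EuclideanSpace ℝ (Fin n)) :=
  {v | ∀ x ∈ K, 0 ≤ inner ℝ v (x - a)}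

/-- `K` is smooth: it has a unique unit normal at each boundary point. -/
def HasUniqueNormals {n : ℕ} (K : Set (EuclideanSpace ℝ (Fin n))) : Prop :=
  ∀ a ∈ frontier K, ∃! v : EuclideanSpace ℝ (Fin n), ‖v‖ = 1 ∧ v ∈ normalCone K a

/-- `K` has an inscribed tangent ball of radius `ε` at `x`. -/
def HasInscribedBall {n : ℕ} (K : Set (EuclideanSpace ℝ (Fin n))) (ε : ℝ)
    (x : EuclideanSpace ℝ (Fin n)) : Prop :=
  ∃ c : EuclideanSpace ℝ (Fin n), x ∈ Metric.sphere c ε ∧ Metric.closedBall c ε ⊆ K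

/-- `K` has a circumscribed tangent ball of radius `ε` at `x`. -/
def HasCircumscribedBall {n : ℕ} (K : Set (EuclideanSpace ℝ (Fin n))) (ε : ℝ)
    (x : EuclideanSpace ℝ (Fin n)) : Prop :=
  ∃ c : EuclideanSpace ℝ (Fin n), x ∈ Metric.sphere c ε ∧ K ⊆ Metric.closedBall c ε

/-- `K` is a smooth ball-like convex body: a compact convex set with nonempty interior, with a
unique unit normal at each boundary point, and with inscribed and circumscribed tangent balls of
uniform positive radii at all boundary points. -/
structure IsBallLike {n : ℕ} (K : Set (EuclideanSpace ℝ (Fin n))) : Prop where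
  isCompact : IsCompact K
  convex : Convex ℝ K
  interior_nonempty : (interior K).Nonempty
  smooth : HasUniqueNormals K
  inscribed : ∃ ε : ℝ, 0 < ε ∧ ∀ x ∈ frontier K, HasInscribedBall K ε x
  circumscribed : ∃ ε : ℝ, 0 < ε ∧ ∀ x ∈ frontier K, HasCircumscribedBall K ε x

/-! Let `a` minimise `f` on `K`. Taylor's formula gives `f x - f a ≤ u x` with `u x = ⟨∇f(a), x - a⟩
+ g ‖x - a‖²`, so `u ≥ 0` on `K` by minimality, and it suffices to find a density `q` with `∫ u q =
O(1 / r²)`. Take `q` proportional to `w ^ (n + 2)`, where `w = (U_k(1 - u / D) / (k + 1))²` and `D`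
bounds `u` on `K`. With `s = D / (2 (k + 1)²)`, the Chebyshev bounds give `w ≤ 1`, `u w ≤ 2 s`, and
`w ≥ 1/4` where `u ≤ s`. Since `u` is subhomogeneous about `a`, shrinking towards `a` shows that the
volume of `{u ≤ 2 ^ j s}` in `K` is at most `2 ^ (j n)` times that of `{u ≤ s}`. The decay of `w ^
(n + 2)` beats this growth, so the mean of `u` under `q` is `O(s)`; taking `k` of order `r / (2 (n +
2))` gives the rate. The argument is carried by `setIntegral_mul_pow_le_of_doubling`,
`Convex.measureReal_sublevel_le` and `exists_isSosDensity_integral_le`. -/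

/-! ### Chebyshev polynomials of the second kind near the endpoint 1. -/

theorem Real.abs_sin_nat_mul_le (m : ℕ) (x : ℝ) : |Real.sin (m * x)| ≤ m * |Real.sin x| := by
  induction m with
  | zero => simp
  | succ m ih =>
    have h : Real.sin ((m + 1 : ℕ) * x)
        = Real.sin (m * x) * Real.cos x + Real.cos (m * x) * Real.sin x := by
      rw [← Real.sin_add]; push_cast; ring_nf
    rw [h]
    calc _ ≤ |Real.sin (m * x)| * |Real.cos x| + |Real.cos (m * x)| * |Real.sin x| := by
          rw [← abs_mul, ← abs_mul]; exact abs_add_le _ _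
      _ ≤ |Real.sin (m * x)| * 1 + 1 * |Real.sin x| := by
          gcongr
          exacts [Real.abs_cos_le_one _, Real.abs_cos_le_one _]
      _ ≤ _ := by push_cast; linarith

/-- On `[0, 1]` the polynomial `u ↦ U_k(1 - u)` is bounded by its value `k + 1` at `0` and by
`u ^ (-1/2)`, and it is at least half of its maximum for `u ≤ 1 / (2 (k + 1) ^ 2)`. -/
theorem Polynomial.Chebyshev.eval_U_one_sub_bounds (k : ℕ) {u : ℝ} (hu0 : 0 ≤ u) (hu1 : u ≤ 1) :
    ((U ℝ k).eval (1 - u)) ^ 2 ≤ (k + 1 : ℝ) ^ 2 ∧ u * ((U ℝ k).eval (1 - u)) ^ 2 ≤ 1 ∧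
      (2 * (k + 1 : ℝ) ^ 2 * u ≤ 1 → (k + 1 : ℝ) / 2 ≤ (U ℝ k).eval (1 - u)) := by
  rcases hu0.eq_or_lt with rfl | hu
  -- The endpoint is separate because the other case divides by `sin θ`, where `1 - u = cos θ`.
  · have h : (U ℝ k).eval (1 - 0) = k + 1 := by simp
    rw [h]
    refine ⟨le_rfl, by simp, fun _ => ?_⟩
    have : (0 : ℝ) ≤ k := by positivity
    linarith
  set θ := Real.arccos (1 - u) with hθ
  have hcos : Real.cos θ = 1 - u := Real.cos_arccos (by linarith) (by linarith)
  have hθ0 : 0 < θ := Real.arccos_pos.2 (by linarith)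
  have hθ1 : θ ≤ Real.pi / 2 := Real.arccos_le_pi_div_two.2 (by linarith)
  have hpi := Real.pi_pos
  have hs : 0 < Real.sin θ := Real.sin_pos_of_pos_of_lt_pi hθ0 (by linarith)
  have hss : Real.sin θ ^ 2 = u * (2 - u) := by
    rw [Real.sin_sq, hcos]; ring
  have hU : (U ℝ k).eval (1 - u) * Real.sin θ = Real.sin ((k + 1 : ℕ) * θ) := by
    rw [← hcos]; simp [U_real_cos]
  set y := (U ℝ k).eval (1 - u)
  have hk : (0 : ℝ) < k + 1 := by positivity
  refine ⟨?_, ?_, fun h => ?_⟩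
  · have h1 := Real.abs_sin_nat_mul_le (k + 1) θ
    rw [← hU, abs_mul] at h1
    have h2 := le_of_mul_le_mul_right h1 (abs_pos.2 hs.ne')
    push_cast at h2
    rw [← sq_abs]
    gcongr
  · have h1 : y ^ 2 * (u * (2 - u)) ≤ 1 := by
      rw [← hss, ← mul_pow, hU]; exact Real.sin_sq_le_one _
    -- Since `u ≤ 1`, the factor `2 - u` is at least 1.
    nlinarith [mul_nonneg (mul_nonneg (sq_nonneg y) hu0) (sub_nonneg.2 hu1)]
  · have h1 := Real.cos_le_one_sub_mul_cos_sq (x := θ) (by rw [abs_of_pos hθ0]; linarith)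
    rw [hcos] at h1
    have h2 : 2 * θ ^ 2 ≤ u * Real.pi ^ 2 := by
      have : 2 / Real.pi ^ 2 * θ ^ 2 * Real.pi ^ 2 = 2 * θ ^ 2 := by field_simp
      rw [← this]; gcongr; linarith
    -- This is the range of Jordan's inequality `sin t ≥ 2 t / π`, applied next to `t = (k + 1) θ`.
    have h3 : (k + 1) * θ ≤ Real.pi / 2 := by
      apply le_of_sq_le_sq _ (by positivity)
      have : 2 * (k + 1 : ℝ) ^ 2 * u * Real.pi ^ 2 ≤ 1 * Real.pi ^ 2 := by gcongr
      nlinarith [mul_le_mul_of_nonneg_left h2 (sq_nonneg (k + 1 : ℝ))]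
    have h4 := Real.mul_le_sin (x := (k + 1) * θ) (by positivity) h3
    have h5 : Real.sin θ ≤ θ := Real.sin_le hθ0.le
    push_cast at hU
    rw [← hU] at h4
    have h6 : (1 : ℝ) / 2 ≤ 2 / Real.pi := by
      rw [div_le_div_iff₀ (by norm_num) hpi]; linarith [Real.pi_le_four]
    have h7 : (k + 1 : ℝ) / 2 * Real.sin θ ≤ y * Real.sin θ := by
      calc (k + 1 : ℝ) / 2 * Real.sin θ ≤ (k + 1 : ℝ) / 2 * θ := by gcongr
        _ = 1 / 2 * ((k + 1) * θ) := by ring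
        _ ≤ 2 / Real.pi * ((k + 1) * θ) := by gcongr
        _ ≤ _ := h4
    exact le_of_mul_le_mul_right h7 hs

theorem MvPolynomial.totalDegree_aeval_le {σ R : Type*} [CommRing R] (p : Polynomial R)
    (g : MvPolynomial σ R) :
    (Polynomial.aeval g p).totalDegree ≤ p.natDegree * g.totalDegree := by
  rw [Polynomial.aeval_eq_sum_range]
  refine totalDegree_finsetSum_le fun i hi => ?_
  refine (totalDegree_smul_le _ _).trans ((totalDegree_pow _ _).trans ?_)
  have := Finset.mem_range.1 hi
  gcongr
  omega

/-! ### Concentration by dyadic decomposition. -/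

/-- If the sublevel sets `{u ≤ 2 ^ k s}` in `K` grow at most like `2 ^ (k n)` and `w` is a bump
that decays like `s / u`, then `w ^ (n + 2)` concentrates where `u` is of order `s`. -/
theorem setIntegral_mul_pow_le_of_doubling {α : Type*} [MeasurableSpace α] {μ : Measure α}
    {K : Set α} (hK : MeasurableSet K) (hKfin : μ K ≠ ⊤) {u w : α → ℝ} (hum : Measurable u)
    {n : ℕ} {s D : ℝ} (hs : 0 < s)
    (hu : ∀ x ∈ K, 0 ≤ u x) (huD : ∀ x ∈ K, u x ≤ D)
    (hdoub : ∀ k : ℕ, μ.real (K ∩ {x | u x ≤ 2 ^ k * s}) ≤ 2 ^ (k * n) * μ.real (K ∩ {x | u x ≤ s}))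
    (hw0 : ∀ x ∈ K, 0 ≤ w x) (hw1 : ∀ x ∈ K, w x ≤ 1) (hwu : ∀ x ∈ K, u x * w x ≤ 2 * s)
    (hws : ∀ x ∈ K, u x ≤ s → 1 / 4 ≤ w x)
    (hint : IntegrableOn (fun x => w x ^ (n + 2)) K μ)
    (hint' : IntegrableOn (fun x => u x * w x ^ (n + 2)) K μ) :
    (1 / 4) ^ (n + 2) * μ.real (K ∩ {x | u x ≤ s}) ≤ ∫ x in K, w x ^ (n + 2) ∂μ ∧
    ∫ x in K, u x * w x ^ (n + 2) ∂μ ≤ s * 16 ^ (n + 2) * ∫ x in K, w x ^ (n + 2) ∂μ := by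
  have hmeas : ∀ t, MeasurableSet (K ∩ {x | u x ≤ t}) := fun t =>
    hK.inter (measurableSet_le hum measurable_const)
  have hfin : ∀ t, μ (K ∩ {x | u x ≤ t}) ≠ ⊤ := fun t =>
    ((measure_mono Set.inter_subset_left).trans_lt hKfin.lt_top).ne
  have hlow : (1 / 4) ^ (n + 2) * μ.real (K ∩ {x | u x ≤ s}) ≤ ∫ x in K, w x ^ (n + 2) ∂μ := by
    calc (1 / 4) ^ (n + 2) * μ.real (K ∩ {x | u x ≤ s})
        = ∫ x in K ∩ {x | u x ≤ s}, (1 / 4 : ℝ) ^ (n + 2) ∂μ := by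
          rw [setIntegral_const, smul_eq_mul, mul_comm]
      _ ≤ ∫ x in K ∩ {x | u x ≤ s}, w x ^ (n + 2) ∂μ := by
          refine setIntegral_mono_on (integrableOn_const (hfin s))
            (hint.mono_set Set.inter_subset_left) (hmeas s) fun x hx => ?_
          have := hws x hx.1 hx.2
          gcongr
      _ ≤ _ := by
          refine setIntegral_mono_set hint ?_ Set.inter_subset_left.eventuallyLE
          filter_upwards [ae_restrict_mem hK] with x hx
          have := hw0 x hx
          positivity
  refine ⟨hlow, ?_⟩
  obtain ⟨M, hM⟩ := pow_unbounded_of_one_lt (D / s) one_lt_two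
  rw [div_lt_iff₀ hs] at hM
  -- For `k ≥ 1`, on the shell `2 ^ (k - 1) s < u ≤ 2 ^ k s` one has `w ≤ 4 / 2 ^ k`. One factor `w`
  -- absorbs `u` through `u w ≤ 2 s`; the other `n + 1` give `c k`, which beats the volume growth `2
  -- ^ (k n)` by a factor `2 ^ k`.
  set c : ℕ → ℝ := fun k => s * 2 ^ (2 * n + 3) / 2 ^ (k * (n + 1)) with hc
  have hc0 : ∀ k, 0 ≤ c k := fun k => by positivity
  have hpt : ∀ x ∈ K, u x * w x ^ (n + 2) ≤
      ∑ k ∈ Finset.range (M + 1), (K ∩ {x | u x ≤ 2 ^ k * s}).indicator (fun _ => c k) x := by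
    intro x hx
    have hex : ∃ k : ℕ, u x ≤ 2 ^ k * s := ⟨M, (huD x hx).trans hM.le⟩
    classical
    -- The least such `k` locates the shell of `x`; its single term already dominates.
    set k := Nat.find hex with hk
    have hkM : k ≤ M := Nat.find_min' hex ((huD x hx).trans hM.le)
    have hks : u x ≤ 2 ^ k * s := Nat.find_spec hex
    have h1 : c k ≤
        ∑ k ∈ Finset.range (M + 1), (K ∩ {x | u x ≤ 2 ^ k * s}).indicator (fun _ => c k) x := by
      have : (K ∩ {x | u x ≤ 2 ^ k * s}).indicator (fun _ => c k) x = c k :=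
        Set.indicator_of_mem (show x ∈ K ∩ {x | u x ≤ 2 ^ k * s} from ⟨hx, hks⟩) _
      rw [← this]
      exact Finset.single_le_sum
        (f := fun k => (K ∩ {x | u x ≤ 2 ^ k * s}).indicator (fun _ => c k) x)
        (fun i _ => Set.indicator_nonneg (fun _ _ => hc0 i) x)
        (Finset.mem_range.2 (Nat.lt_succ_of_le hkM))
    refine le_trans ?_ h1
    have hwx := hw0 x hx
    have hux := hu x hx
    rcases Nat.eq_zero_or_pos k with h0 | hpos
    · rw [h0] at hks ⊢
      have : u x * w x ^ (n + 2) ≤ s * 1 := by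
        gcongr
        · simpa using hks
        · exact pow_le_one₀ hwx (hw1 x hx)
      refine this.trans ?_
      simp only [hc, zero_mul, pow_zero, div_one]
      gcongr
      exact one_le_pow₀ one_le_two
    · obtain ⟨j, hj⟩ : ∃ j, k = j + 1 := ⟨k - 1, by omega⟩
      have hlt : 2 ^ j * s < u x := not_le.1 (Nat.find_min hex (m := j) (by omega))
      have hw2 : 2 ^ j * w x ≤ 2 := by
        have : 2 ^ j * s * w x ≤ 2 * s := le_trans (by gcongr) (hwu x hx)
        exact le_of_mul_le_mul_right (by linarith) hs
      have h2 : (2 ^ j * w x) ^ (n + 1) ≤ 2 ^ (n + 1) := by gcongr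
      have h3 : u x * w x ^ (n + 2) * 2 ^ (j * (n + 1)) ≤ 2 * s * 2 ^ (n + 1) := by
        calc _ = (u x * w x) * (2 ^ j * w x) ^ (n + 1) := by rw [mul_pow, ← pow_mul]; ring
          _ ≤ _ := mul_le_mul (hwu x hx) h2 (by positivity) (by positivity)
      simp only [hc]
      rw [le_div_iff₀ (by positivity), hj]
      calc u x * w x ^ (n + 2) * 2 ^ ((j + 1) * (n + 1))
          = (u x * w x ^ (n + 2) * 2 ^ (j * (n + 1))) * 2 ^ (n + 1) := by ring
        _ ≤ 2 * s * 2 ^ (n + 1) * 2 ^ (n + 1) := by gcongr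
        _ = _ := by ring
  have hci : ∀ k, Integrable ((K ∩ {x | u x ≤ 2 ^ k * s}).indicator (fun _ => c k)) μ := fun k =>
    (integrable_indicator_iff (hmeas _)).2 (integrableOn_const (hfin _))
  set V := μ.real (K ∩ {x | u x ≤ s})
  have hV : 0 ≤ V := measureReal_nonneg
  have hterm : ∀ k, ∫ x in K, (K ∩ {x | u x ≤ 2 ^ k * s}).indicator (fun _ => c k) x ∂μ
      ≤ s * 2 ^ (2 * n + 3) * V * (1 / 2) ^ k := by
    intro k
    rw [setIntegral_indicator (hmeas _), setIntegral_const, smul_eq_mul, ← Set.inter_assoc,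
      Set.inter_self]
    calc _ ≤ 2 ^ (k * n) * V * c k := mul_le_mul_of_nonneg_right (hdoub k) (hc0 k)
      _ = _ := by
        simp only [hc]
        rw [mul_add, pow_add, mul_one, one_div, inv_pow]
        field_simp
        ring
  calc ∫ x in K, u x * w x ^ (n + 2) ∂μ
      ≤ ∫ x in K, ∑ k ∈ Finset.range (M + 1),
          (K ∩ {x | u x ≤ 2 ^ k * s}).indicator (fun _ => c k) x ∂μ :=
        setIntegral_mono_on hint' (integrable_finsetSum _ fun k _ => (hci k).integrableOn) hK hpt
    _ = ∑ k ∈ Finset.range (M + 1),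
          ∫ x in K, (K ∩ {x | u x ≤ 2 ^ k * s}).indicator (fun _ => c k) x ∂μ :=
        integral_finsetSum _ fun k _ => (hci k).integrableOn
    _ ≤ ∑ k ∈ Finset.range (M + 1), s * 2 ^ (2 * n + 3) * V * (1 / 2) ^ k :=
        Finset.sum_le_sum fun k _ => hterm k
    _ ≤ s * 2 ^ (2 * n + 3) * V * 2 := by
        rw [← Finset.mul_sum]
        gcongr
        exact sum_geometric_two_le _
    _ = s * 16 ^ (n + 2) * ((1 / 4) ^ (n + 2) * V) := by
        have : (16 : ℝ) ^ (n + 2) * (1 / 4) ^ (n + 2) = 2 ^ (2 * n + 3) * 2 := by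
          rw [← mul_pow, ← pow_succ, show 2 * n + 3 + 1 = 2 * (n + 2) by ring, pow_mul]
          norm_num
        linear_combination -(s * V) * this
    _ ≤ _ := by gcongr

/-! ### Taylor bound, smoothness, and volume growth of sublevel sets. -/

/-- Second-order Taylor upper bound on a convex set on which the Hessian is bounded. -/
theorem Convex.sub_le_inner_gradient_add {E : Type*} [NormedAddCommGroup E]
    [InnerProductSpace ℝ E] [CompleteSpace E] {K : Set E} (hK : Convex ℝ K) {f : E → ℝ}
    (hf : Differentiable ℝ f) (hg : Differentiable ℝ (gradient f)) {g : ℝ}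
    (hgK : ∀ x ∈ K, ‖fderiv ℝ (gradient f) x‖ ≤ 2 * g) {a x : E} (ha : a ∈ K) (hx : x ∈ K) :
    f x - f a ≤ inner ℝ (gradient f a) (x - a) + g * ‖x - a‖ ^ 2 := by
  set v := x - a
  set φ : ℝ → ℝ := fun t => f (a + t • v) - (t * inner ℝ (gradient f a) v + t ^ 2 * (g * ‖v‖ ^ 2))
  have hmem : ∀ t ∈ Set.Icc (0 : ℝ) 1, a + t • v ∈ K := fun t ht =>
    hK.add_smul_sub_mem ha hx ht
  have hline : ∀ t : ℝ, HasDerivAt (fun t : ℝ => a + t • v) v t := fun t => by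
    simpa using ((hasDerivAt_id t).smul_const v).const_add a
  have hφ : ∀ t, HasDerivAt φ (inner ℝ (gradient f (a + t • v)) v -
      (inner ℝ (gradient f a) v + 2 * t * (g * ‖v‖ ^ 2))) t := by
    intro t
    have h1 : HasDerivAt (fun t : ℝ => f (a + t • v)) (inner ℝ (gradient f (a + t • v)) v) t := by
      have := (hf (a + t • v)).hasFDerivAt.comp_hasDerivAt t (hline t)
      rw [(hf (a + t • v)).hasGradientAt.hasFDerivAt.fderiv] at this
      simpa [Function.comp_def] using this
    have h2 : HasDerivAt (fun t : ℝ => t * inner ℝ (gradient f a) v)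
        (inner ℝ (gradient f a) v) t := by
      simpa using (hasDerivAt_id t).mul_const (inner ℝ (gradient f a) v)
    have h3 : HasDerivAt (fun t : ℝ => t ^ 2 * (g * ‖v‖ ^ 2)) (2 * t * (g * ‖v‖ ^ 2)) t := by
      simpa using (hasDerivAt_pow 2 t).mul_const (g * ‖v‖ ^ 2)
    exact h1.sub (h2.add h3)
  -- The gradient is `2 g`-Lipschitz on `K`, so `φ' ≤ 0`; comparing `φ 1` with `φ 0` gives the
  -- claim.
  have hanti : AntitoneOn φ (Set.Icc 0 1) := by
    refine antitoneOn_of_deriv_nonpos (convex_Icc 0 1)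
      (fun t _ => (hφ t).continuousAt.continuousWithinAt)
      (fun t _ => (hφ t).differentiableAt.differentiableWithinAt) fun t ht => ?_
    rw [interior_Icc] at ht
    have ht' : t ∈ Set.Icc (0 : ℝ) 1 := Set.Ioo_subset_Icc_self ht
    rw [(hφ t).deriv]
    have hlip := hK.norm_image_sub_le_of_norm_fderiv_le (𝕜 := ℝ) (fun x _ => hg x) hgK ha
      (hmem t ht')
    have h4 : inner ℝ (gradient f (a + t • v) - gradient f a) v ≤ 2 * t * (g * ‖v‖ ^ 2) := by
      calc _ ≤ ‖gradient f (a + t • v) - gradient f a‖ * ‖v‖ := real_inner_le_norm _ _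
        _ ≤ (2 * g * ‖a + t • v - a‖) * ‖v‖ := by gcongr
        _ = _ := by
          rw [add_sub_cancel_left, norm_smul, Real.norm_of_nonneg ht'.1]; ring
    rw [inner_sub_left] at h4
    linarith
  have h01 := hanti (Set.left_mem_Icc.2 zero_le_one) (Set.right_mem_Icc.2 zero_le_one) zero_le_one
  simp only [φ, v, one_smul, zero_smul, add_sub_cancel, add_zero] at h01
  simp only [v]
  linarith

theorem contDiff_polyFun {n : ℕ} (f : MvPolynomial (Fin n) ℝ) {k : WithTop ℕ∞} :
    ContDiff ℝ k (polyFun f) := by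
  unfold polyFun
  induction f using MvPolynomial.induction_on with
  | C c => simpa using contDiff_const
  | add p q hp hq => simpa using hp.add hq
  | mul_X p i hp =>
    have : ContDiff ℝ k (fun x : EuclideanSpace ℝ (Fin n) => x i) :=
      (EuclideanSpace.proj i : EuclideanSpace ℝ (Fin n) →L[ℝ] ℝ).contDiff
    simpa using hp.mul this

theorem contDiff_gradient_polyFun {n : ℕ} (f : MvPolynomial (Fin n) ℝ) :
    ContDiff ℝ 1 (gradient (polyFun f)) :=
  (InnerProductSpace.toDual ℝ (EuclideanSpace ℝ (Fin n))).symm.contDiff.comp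
    ((contDiff_polyFun f (k := 2)).fderiv_right (m := 1) (by norm_num))

/-- Sublevel sets in a convex set of a function that is subhomogeneous about a point `a` of the
set grow at most like the power of the dimension. -/
theorem Convex.measureReal_sublevel_le {E : Type*} [NormedAddCommGroup E] [NormedSpace ℝ E]
    [MeasurableSpace E] [BorelSpace E] [FiniteDimensional ℝ E] (μ : Measure E)
    [μ.IsAddHaarMeasure] {K : Set E} (hK : Convex ℝ K) (hfin : μ K ≠ ⊤) {u : E → ℝ} {a : E}
    (ha : a ∈ K) (hsub : ∀ x ∈ K, ∀ θ ∈ Set.Icc (0 : ℝ) 1, u (a + θ • (x - a)) ≤ θ * u x)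
    {c : ℝ} (hc : 1 ≤ c) (s : ℝ) :
    μ.real (K ∩ {x | u x ≤ c * s}) ≤
      c ^ Module.finrank ℝ E * μ.real (K ∩ {x | u x ≤ s}) := by
  have hc0 : 0 < c := by linarith
  have hθ : c⁻¹ ∈ Set.Icc (0 : ℝ) 1 := ⟨by positivity, inv_le_one_of_one_le₀ hc⟩
  -- Contraction towards `a` by `1 / c` keeps points in `K` and divides the bound on `u` by `c`,
  -- while scaling volume by `c⁻¹ ^ dim`.
  have himg : AffineMap.homothety a c⁻¹ '' (K ∩ {x | u x ≤ c * s}) ⊆ K ∩ {x | u x ≤ s} := by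
    rintro _ ⟨x, ⟨hx, hux⟩, rfl⟩
    have he : AffineMap.homothety a c⁻¹ x = a + c⁻¹ • (x - a) := by
      simp [AffineMap.homothety_apply, add_comm]
    rw [he]
    refine ⟨hK.add_smul_sub_mem ha hx hθ, (hsub x hx _ hθ).trans ?_⟩
    rw [inv_mul_le_iff₀ hc0]
    exact hux
  have h1 : μ.real (AffineMap.homothety a c⁻¹ '' (K ∩ {x | u x ≤ c * s})) ≤
      μ.real (K ∩ {x | u x ≤ s}) :=
    measureReal_mono himg ((measure_mono Set.inter_subset_left).trans_lt hfin.lt_top).ne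
  rw [measureReal_def, Measure.addHaar_image_homothety, ENNReal.toReal_mul,
    ENNReal.toReal_ofReal (abs_nonneg _), abs_of_nonneg (by positivity), ← measureReal_def] at h1
  rwa [inv_pow, inv_mul_le_iff₀ (by positivity)] at h1

/-! ### Sum-of-squares densities. -/

theorem polyFun_nonneg_of_isSumSq {n : ℕ} {q : MvPolynomial (Fin n) ℝ} (hq : IsSumSq q)
    (x : EuclideanSpace ℝ (Fin n)) : 0 ≤ polyFun q x := by
  induction hq with
  | zero => simp [polyFun]
  | sq_add p _ ih =>
    simp only [polyFun, map_add, map_mul] at ih ⊢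
    exact add_nonneg (mul_self_nonneg _) ih

theorem integrableOn_polyFun_mul {n : ℕ} {K : Set (EuclideanSpace ℝ (Fin n))} (hK : IsCompact K)
    (f q : MvPolynomial (Fin n) ℝ) : IntegrableOn (fun x => polyFun f x * polyFun q x) K :=
  ((contDiff_polyFun f (k := 0)).continuous.mul
    (contDiff_polyFun q (k := 0)).continuous).continuousOn.integrableOn_compact hK

/-- A real `sInf` lies below each member only if the set is bounded below; integrating `f ≥ f_min`
against any density supplies the bound `f_min`. -/
theorem lasserreBound_le {n r : ℕ} {K : Set (EuclideanSpace ℝ (Fin n))} (hK : IsCompact K)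
    {f q : MvPolynomial (Fin n) ℝ} (hq : IsSosDensity r K volume q) :
    lasserreBound r K volume f ≤ ∫ x in K, polyFun f x * polyFun q x := by
  refine csInf_le ⟨polyMinOn K f, ?_⟩ ⟨q, hq, rfl⟩
  rintro _ ⟨p, ⟨hp, -, hp1⟩, rfl⟩
  have hbdd : BddBelow (polyFun f '' K) :=
    (hK.image (contDiff_polyFun f (k := 0)).continuous).bddBelow
  calc polyMinOn K f = ∫ x in K, polyMinOn K f * polyFun p x := by
        rw [integral_const_mul, hp1, mul_one]
    _ ≤ _ := by
        refine setIntegral_mono_on ?_ (integrableOn_polyFun_mul hK f p) hK.measurableSet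
          fun x hx => ?_
        · exact (continuous_const.mul
            (contDiff_polyFun p (k := 0)).continuous).continuousOn.integrableOn_compact hK
        · exact mul_le_mul_of_nonneg_right (csInf_le hbdd ⟨x, hx, rfl⟩)
            (polyFun_nonneg_of_isSumSq hp x)

/-- The quadratic polynomial `⟨v, x - a⟩ + g ‖x - a‖²`. -/
noncomputable def quadraticPoly {n : ℕ} (v a : EuclideanSpace ℝ (Fin n)) (g : ℝ) :
    MvPolynomial (Fin n) ℝ :=
  ∑ i, (MvPolynomial.C (v i) * (MvPolynomial.X i - MvPolynomial.C (a i)) +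
    MvPolynomial.C g * (MvPolynomial.X i - MvPolynomial.C (a i)) ^ 2)

theorem polyFun_quadraticPoly {n : ℕ} (v a : EuclideanSpace ℝ (Fin n)) (g : ℝ)
    (x : EuclideanSpace ℝ (Fin n)) :
    polyFun (quadraticPoly v a g) x = inner ℝ v (x - a) + g * ‖x - a‖ ^ 2 := by
  simp only [polyFun, quadraticPoly, map_sum, map_add, map_mul, map_sub, map_pow,
    MvPolynomial.eval_C, MvPolynomial.eval_X, Finset.sum_add_distrib, ← Finset.mul_sum,
    EuclideanSpace.real_norm_sq_eq, PiLp.inner_apply, PiLp.sub_apply, RCLike.inner_apply,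
    conj_trivial]
  simp only [mul_comm]

theorem totalDegree_quadraticPoly_le {n : ℕ} (v a : EuclideanSpace ℝ (Fin n)) (g : ℝ) :
    (quadraticPoly v a g).totalDegree ≤ 2 := by
  refine MvPolynomial.totalDegree_finsetSum_le fun i _ => ?_
  have h : (MvPolynomial.X i - MvPolynomial.C (a i) : MvPolynomial (Fin n) ℝ).totalDegree ≤ 1 :=
    (MvPolynomial.totalDegree_sub_C_le _ _).trans (MvPolynomial.totalDegree_X i).le
  have h2 := MvPolynomial.totalDegree_pow
    (MvPolynomial.X i - MvPolynomial.C (a i) : MvPolynomial (Fin n) ℝ) 2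
  refine (MvPolynomial.totalDegree_add _ _).trans (max_le ?_ ?_)
  · refine (MvPolynomial.totalDegree_mul _ _).trans ?_
    rw [MvPolynomial.totalDegree_C]
    omega
  · refine (MvPolynomial.totalDegree_mul _ _).trans ?_
    rw [MvPolynomial.totalDegree_C]
    omega

/-- A sum-of-squares density of degree at most `4 k (n + 2)` concentrating near a zero of a
quadratic polynomial `u` that is nonnegative on `K` and subhomogeneous about that zero. -/
theorem exists_isSosDensity_integral_le {n : ℕ} {K : Set (EuclideanSpace ℝ (Fin n))}
    (hK : IsCompact K) (hconv : Convex ℝ K) (hint : (interior K).Nonempty)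
    {u : MvPolynomial (Fin n) ℝ} (hdeg : u.totalDegree ≤ 2) {D : ℝ} (hD : 0 < D)
    (hu : ∀ x ∈ K, 0 ≤ polyFun u x) (huD : ∀ x ∈ K, polyFun u x ≤ D)
    {a : EuclideanSpace ℝ (Fin n)} (ha : a ∈ K)
    (hsub : ∀ x ∈ K, ∀ θ ∈ Set.Icc (0 : ℝ) 1, polyFun u (a + θ • (x - a)) ≤ θ * polyFun u x)
    {k r : ℕ} (hkr : 2 * k * (n + 2) ≤ r) :
    ∃ q, IsSosDensity r K volume q ∧
      ∫ x in K, polyFun u x * polyFun q x ≤ D / (2 * (k + 1) ^ 2) * 16 ^ (n + 2) := by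
  set U := Polynomial.Chebyshev.U ℝ (k : ℤ)
  set p : MvPolynomial (Fin n) ℝ := MvPolynomial.C ((k + 1 : ℝ)⁻¹) *
    Polynomial.aeval (1 - MvPolynomial.C D⁻¹ * u) U with hp
  have hpe : ∀ x, polyFun p x = (k + 1 : ℝ)⁻¹ * U.eval (1 - D⁻¹ * polyFun u x) := by
    intro x
    simp only [polyFun, hp, map_mul, MvPolynomial.eval_C]
    congr 1
    rw [← MvPolynomial.coe_aeval_eq_eval, RingHom.coe_coe, ← Polynomial.aeval_algHom_apply]
    simp [Polynomial.coe_aeval_eq_eval]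
  have hpd : p.totalDegree ≤ k * 2 := by
    refine (MvPolynomial.totalDegree_mul _ _).trans ?_
    rw [MvPolynomial.totalDegree_C, zero_add]
    refine (MvPolynomial.totalDegree_aeval_le _ _).trans ?_
    rw [Polynomial.Chebyshev.natDegree_U_natCast]
    gcongr
    refine (MvPolynomial.totalDegree_sub _ _).trans (max_le (by simp) ?_)
    refine (MvPolynomial.totalDegree_mul _ _).trans ?_
    rw [MvPolynomial.totalDegree_C, zero_add]
    exact hdeg
  have hcont : ∀ f : MvPolynomial (Fin n) ℝ, Continuous (polyFun f) := fun f =>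
    (contDiff_polyFun f (k := 0)).continuous
  have hk : (0 : ℝ) < k + 1 := by positivity
  have hbounds : ∀ x ∈ K, polyFun p x ^ 2 ≤ 1 ∧
      polyFun u x * polyFun p x ^ 2 ≤ 2 * (D / (2 * (k + 1) ^ 2)) ∧
      (polyFun u x ≤ D / (2 * (k + 1) ^ 2) → 1 / 4 ≤ polyFun p x ^ 2) := by
    intro x hx
    have h0 : 0 ≤ D⁻¹ * polyFun u x := mul_nonneg (by positivity) (hu x hx)
    have h1 : D⁻¹ * polyFun u x ≤ 1 := by
      rw [inv_mul_le_iff₀ hD, mul_one]; exact huD x hx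
    obtain ⟨b1, b2, b3⟩ := Polynomial.Chebyshev.eval_U_one_sub_bounds k h0 h1
    rw [hpe]
    refine ⟨?_, ?_, fun h => ?_⟩
    · rw [mul_pow, inv_pow, inv_mul_le_iff₀ (by positivity), mul_one]
      exact b1
    · rw [mul_assoc, inv_mul_le_iff₀ hD, mul_one] at b2
      rw [mul_pow, mul_left_comm, inv_pow, inv_mul_le_iff₀ (by positivity)]
      exact b2.trans (by field_simp; rfl)
    · rw [le_div_iff₀ (by positivity)] at h
      have := b3 (by
        rw [mul_left_comm, inv_mul_le_iff₀ hD]; linarith)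
      have h2 : (1 : ℝ) / 2 ≤ (k + 1 : ℝ)⁻¹ * U.eval (1 - D⁻¹ * polyFun u x) := by
        rw [le_inv_mul_iff₀ hk]; linarith
      nlinarith
  set s := D / (2 * (k + 1 : ℝ) ^ 2)
  have hs : 0 < s := by positivity
  have hdoub : ∀ j : ℕ, volume.real (K ∩ {x | polyFun u x ≤ 2 ^ j * s}) ≤
      2 ^ (j * n) * volume.real (K ∩ {x | polyFun u x ≤ s}) := by
    intro j
    have := hconv.measureReal_sublevel_le volume hK.measure_lt_top.ne ha hsub
      (c := 2 ^ j) (one_le_pow₀ one_le_two) s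
    rwa [finrank_euclideanSpace_fin, ← pow_mul] at this
  obtain ⟨hlow, hup⟩ := setIntegral_mul_pow_le_of_doubling (μ := volume)
    (w := fun x => polyFun p x ^ 2)
    hK.measurableSet hK.measure_lt_top.ne
    (hcont u).measurable (n := n) (D := D) hs hu huD hdoub (fun x _ => sq_nonneg _)
    (fun x hx => (hbounds x hx).1) (fun x hx => (hbounds x hx).2.1)
    (fun x hx => (hbounds x hx).2.2)
    (((hcont p).pow 2).pow (n + 2) |>.continuousOn.integrableOn_compact hK)
    ((hcont u).mul (((hcont p).pow 2).pow (n + 2)) |>.continuousOn.integrableOn_compact hK)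
  -- For large `M` the sublevel set at `2 ^ M s` is all of `K`, so doubling carries positivity of
  -- the volume of `K` down to level `s`.
  have hV : 0 < volume.real (K ∩ {x | polyFun u x ≤ s}) := by
    obtain ⟨M, hM⟩ := pow_unbounded_of_one_lt (D / s) one_lt_two
    rw [div_lt_iff₀ hs] at hM
    have h1 := hdoub M
    rw [(Set.inter_eq_left (t := {x | polyFun u x ≤ 2 ^ M * s})).2
      fun x hx => (huD x hx).trans hM.le] at h1
    have h2 : 0 < volume.real K := ENNReal.toReal_pos
      ((Measure.measure_pos_of_nonempty_interior volume hint).ne') hK.measure_lt_top.ne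
    exact pos_of_mul_pos_right (h2.trans_le h1) (by positivity)
  set I := ∫ x in K, (polyFun p x ^ 2) ^ (n + 2)
  have hI : 0 < I := lt_of_lt_of_le (by positivity) hlow
  set P : MvPolynomial (Fin n) ℝ := MvPolynomial.C (Real.sqrt I)⁻¹ * p ^ (n + 2) with hP
  have hPP : ∀ x, polyFun (P * P) x = I⁻¹ * (polyFun p x ^ 2) ^ (n + 2) := by
    intro x
    simp only [polyFun, hP, map_mul, map_pow, MvPolynomial.eval_C]
    rw [← pow_mul, mul_comm 2, pow_mul, mul_mul_mul_comm, ← mul_inv,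
      Real.mul_self_sqrt hI.le, sq]
  refine ⟨P * P, ⟨IsSumSq.mul_self P, ?_, ?_⟩, ?_⟩
  · have h1 : P.totalDegree ≤ (n + 2) * (k * 2) := by
      refine (MvPolynomial.totalDegree_mul _ _).trans ?_
      rw [MvPolynomial.totalDegree_C, zero_add]
      refine (MvPolynomial.totalDegree_pow _ _).trans ?_
      gcongr
    have h2 : (n + 2) * (k * 2) ≤ r := by linarith
    have := MvPolynomial.totalDegree_mul P P
    omega
  · simp_rw [hPP]
    rw [integral_const_mul, inv_mul_cancel₀ hI.ne']
  · simp_rw [hPP, mul_left_comm _ I⁻¹]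
    rw [integral_const_mul, inv_mul_le_iff₀ hI]
    linarith

/-! ### The convergence rate. -/

/-- The Lasserre upper bounds of a polynomial on a convex body converge at rate `1 / r ^ 2`. -/
theorem lasserreError_le {n : ℕ} {K : Set (EuclideanSpace ℝ (Fin n))} (hK : IsCompact K)
    (hconv : Convex ℝ K) (hint : (interior K).Nonempty) (f : MvPolynomial (Fin n) ℝ) {r : ℕ}
    (hr : 1 ≤ r) :
    lasserreError r K volume f ≤ 2 * (n + 2) ^ 2 * 16 ^ (n + 2) * (|gradBound K f| * Metric.diam K
      + |hessBound K f| * Metric.diam K ^ 2 + 1) / (r : ℝ) ^ 2 := by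
  have hcont : ∀ f : MvPolynomial (Fin n) ℝ, Continuous (polyFun f) := fun f =>
    (contDiff_polyFun f (k := 0)).continuous
  obtain ⟨a, ha, hamin, hale⟩ := hK.exists_sInf_image_eq_and_le (hint.mono interior_subset)
    (hcont f).continuousOn
  have hgrad := contDiff_gradient_polyFun f
  set b := gradBound K f
  set g := hessBound K f with hg
  have hb : ‖gradient (polyFun f) a‖ ≤ b :=
    le_csSup (hK.image hgrad.continuous.norm).bddAbove ⟨a, ha, rfl⟩
  have hgK : ∀ x ∈ K, ‖fderiv ℝ (gradient (polyFun f)) x‖ ≤ 2 * g := by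
    intro x hx
    have := le_csSup (hK.image (hgrad.continuous_fderiv (by norm_num)).norm).bddAbove
      (Set.mem_image_of_mem _ hx)
    rw [hg, hessBound]
    linarith
  have hg0 : 0 ≤ g := by linarith [(norm_nonneg _).trans (hgK a ha)]
  set Δ := Metric.diam K
  have hΔ : 0 ≤ Δ := Metric.diam_nonneg
  set v := gradient (polyFun f) a
  -- The `+ 1` keeps `D` positive even when `b` and `g` vanish.
  set D := |b| * Δ + |g| * Δ ^ 2 + 1
  have hD : 0 < D := by positivity
  set u := quadraticPoly v a g
  have hue : ∀ x, polyFun u x = inner ℝ v (x - a) + g * ‖x - a‖ ^ 2 := polyFun_quadraticPoly v a g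
  have hfu : ∀ x ∈ K, polyFun f x - polyFun f a ≤ polyFun u x := fun x hx => by
    rw [hue]
    exact hconv.sub_le_inner_gradient_add ((contDiff_polyFun f (k := 1)).differentiable one_ne_zero)
      (hgrad.differentiable one_ne_zero) hgK ha hx
  have hu0 : ∀ x ∈ K, 0 ≤ polyFun u x := fun x hx =>
    (sub_nonneg.2 (hale x hx)).trans (hfu x hx)
  have huD : ∀ x ∈ K, polyFun u x ≤ D := by
    intro x hx
    have hd : ‖x - a‖ ≤ Δ := by
      rw [← dist_eq_norm]; exact Metric.dist_le_diam_of_mem hK.isBounded hx ha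
    rw [hue]
    calc _ ≤ ‖v‖ * ‖x - a‖ + g * ‖x - a‖ ^ 2 := by gcongr; exact real_inner_le_norm _ _
      _ ≤ |b| * Δ + |g| * Δ ^ 2 := by
          gcongr
          exacts [hb.trans (le_abs_self b), le_abs_self g]
      _ ≤ D := by simp [D]
  have hsub : ∀ x ∈ K, ∀ θ ∈ Set.Icc (0 : ℝ) 1,
      polyFun u (a + θ • (x - a)) ≤ θ * polyFun u x := by
    intro x _ θ hθ
    rw [hue, hue, add_sub_cancel_left, inner_smul_right, norm_smul, Real.norm_of_nonneg hθ.1]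
    have : θ * (θ * (g * ‖x - a‖ ^ 2)) ≤ 1 * (θ * (g * ‖x - a‖ ^ 2)) := by
      have := hθ.1
      exact mul_le_mul_of_nonneg_right hθ.2 (by positivity)
    linarith
  -- Rounding down meets the degree bound, and `r ≤ 2 (n + 2) (k + 1)` still holds. As `k + 1` is
  -- what enters the estimate, small `r` with `k = 0` needs no separate case.
  set k := r / (2 * (n + 2)) with hk
  have hkr : 2 * k * (n + 2) ≤ r := by
    have := Nat.div_mul_le_self r (2 * (n + 2))
    rw [← hk] at this
    linarith
  have hrk : r ≤ (k + 1) * (2 * (n + 2)) := by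
    have := Nat.lt_div_mul_add (a := r) (b := 2 * (n + 2)) (by positivity)
    rw [← hk] at this
    linarith
  obtain ⟨q, hq, hqu⟩ := exists_isSosDensity_integral_le hK hconv hint
    (totalDegree_quadraticPoly_le v a g) hD hu0 huD ha hsub hkr
  have hfq : ∫ x in K, polyFun f x * polyFun q x ≤
      polyFun f a + ∫ x in K, polyFun u x * polyFun q x := by
    have hqi : IntegrableOn (fun x => polyFun f a * polyFun q x) K :=
      (continuous_const.mul (hcont q)).continuousOn.integrableOn_compact hK
    calc _ ≤ ∫ x in K, (polyFun f a * polyFun q x + polyFun u x * polyFun q x) := by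
          refine setIntegral_mono_on (integrableOn_polyFun_mul hK f q)
            (hqi.add (integrableOn_polyFun_mul hK u q)) hK.measurableSet fun x hx => ?_
          rw [← add_mul]
          have := hfu x hx
          exact mul_le_mul_of_nonneg_right (by linarith) (polyFun_nonneg_of_isSumSq hq.1 x)
      _ = _ := by
          rw [integral_add hqi (integrableOn_polyFun_mul hK u q), integral_const_mul, hq.2.2,
            mul_one]
  have hr0 : (0 : ℝ) < r := by exact_mod_cast hr
  have hrk' : (r : ℝ) ≤ (k + 1) * (2 * (n + 2)) := by exact_mod_cast hrk
  calc lasserreError r K volume f ≤ D / (2 * (k + 1) ^ 2) * 16 ^ (n + 2) := by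
        have h1 := lasserreBound_le hK (f := f) hq
        have h2 : polyMinOn K f = polyFun f a := hamin
        rw [lasserreError, h2]
        linarith
    _ ≤ _ := by
        rw [div_mul_eq_mul_div, div_le_div_iff₀ (by positivity) (by positivity)]
        have h3 : (r : ℝ) ^ 2 ≤ ((k + 1) * (2 * (n + 2))) ^ 2 := by gcongr
        calc D * 16 ^ (n + 2) * (r : ℝ) ^ 2
            ≤ D * 16 ^ (n + 2) * ((k + 1) * (2 * (n + 2))) ^ 2 := by gcongr
          _ = _ := by ring

theorem mainTheorem5 {n : ℕ} (K : Set (EuclideanSpace ℝ (Fin n))) (hK : IsBallLike K) :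
    ∃ C : ℝ → ℝ → ℝ, (∀ b g : ℝ, 0 < C b g) ∧
      ∀ (f : MvPolynomial (Fin n) ℝ) (r : ℕ), 1 ≤ r →
        lasserreError r K volume f ≤ C (gradBound K f) (hessBound K f) / (r : ℝ) ^ 2 := by
  -- The absolute values make the constant positive for all real `b` and `g`.
  refine ⟨fun b g => 2 * (n + 2) ^ 2 * 16 ^ (n + 2) *
    (|b| * Metric.diam K + |g| * Metric.diam K ^ 2 + 1), fun b g => ?_, fun f r hr =>
    lasserreError_le hK.isCompact hK.convex hK.interior_nonempty f hr⟩
  have : 0 ≤ Metric.diam K := Metric.diam_nonneg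
  positivity
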